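/- A semifield is a set $S$ with two associative and commutative operations $+$ and $\times$ such that $\times$ distributes over $+$, there is an element $0$ which is an identity for $+$ and a zero element for $\times$, and $S\setminus\{0\}$ is a group under $\times$. For a semifield $S$ and a natural number $n$, let $M_n(S)$ denote the $n\times n$ matrices over $S$, viewed both as an $S$-module and as a monoid under matrix multiplication, and let $GL_n(S)$ be the group of invertible elements of this monoid. For $A,B\in M_n(S)$ write $A\leq_{\mathcal L}B$ if $A=XB$ for some $X\in M_n(S)$, and $A\leq_{\mathcal R}B$ if $A=BX$ for some $X\in M_n(S)$; write $A\,\mathcal L\,B$ if $A\leq_{\mathcal L}B$ and $B\leq_{\mathcal L}A$, and $A\,\mathcal R\,B$ if $A\leq_{\mathcal R}B$ and $B\leq_{\mathcal R}A$. A map $T\colon M_n(S)\to M_n(S)$ preserves a binary relation $\equiv$ on $M_n(S)$ if $A\equiv B$ implies $T(A)\equiv T(B)$ for all $A,B\in M_n(S)$. **Theorem.** Let $S$ be any semifield (for instance, any field), let $n$ be a natural number, and let $T\colon M_n(S)\to M_n(S)$ be a bijective $S$-linear map. The following are equivalent: 1. $T$ preserves $\mathcal L$; 2. $T$ preserves $\mathcal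 R$; 3. $T$ preserves $\leq_{\mathcal L}$; 4. $T$ preserves $\leq_{\mathcal R}$; 5. there exist $P,Q\in GL_n(S)$ such that $T(A)=PAQ$ for all $A\in M_n(S)$. -/

import Mathlib

namespace Green

/-- The Green pre-order `≤_L` of a monoid: `a ≤_L b` iff `a = s * b` for some `s`. -/
def LeL {M : Type*} [Monoid M] (a b : M) : Prop := ∃ s : M, a = s * b

/-- The Green pre-order `≤_R` of a monoid: `a ≤_R b` iff `a = b * s` for some `s`. -/
def LeR {M : Type*} [Monoid M] (a b : M) : Prop := ∃ s : M, a = b * s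

/-- Green's relation `L` of a monoid. -/
def RelL {M : Type*} [Monoid M] (a b : M) : Prop := LeL a b ∧ LeL b a

/-- Green's relation `R` of a monoid. -/
def RelR {M : Type*} [Monoid M] (a b : M) : Prop := LeR a b ∧ LeR b a

/-- The function `f` (weakly) preserves the binary relation `r`. -/
def Preserves {X : Type*} (r : X → X → Prop) (f : X → X) : Prop :=
  ∀ a b : X, r a b → r (f a) (f b)

end Green

namespace Green

open Matrix

/-! The substance is that preserving `RelL` forces the form `P * A * Q`; transposition gives the
`RelR` case. A semifield either contains `-1`, hence is a field, or has no nonzero additive units.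

Over a field, units span the matrix ring, so `T` sends the left ideal of `B` into the span of left
multiples of `T B`. Hence `T.symm` permits a description `x ⊗ ψ ↦ b_ψ x ⊗ φ_ψ`
(`exists_symm_vecMulVec_eq`), and testing on sums of basis vectors makes all `b_ψ` on the basis
proportional.

Without additive inverses there is no cancellation, so `T` permutes matrix units up to scalars
(`exists_map_single_eq`); `RelL` then splits both the permutation and the scalars into a row factor
and a column factor. -/

theorem relL_units_mul {M : Type*} [Monoid M] (u : Mˣ) (a : M) : RelL (↑u * a) a :=
  ⟨⟨u, rfl⟩, ⟨↑u⁻¹, (u.inv_mul_cancel_left a).symm⟩⟩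

/-! ### Rank-one matrices with a fixed row vector -/

section Outer

variable {ι K : Type*} [Field K]

theorem vecMulVecBilin_flip_injective {ψ : ι → K} (hψ : ψ ≠ 0) :
    Function.Injective ((vecMulVecBilin K K (m := ι)).flip ψ) := by
  rw [← LinearMap.ker_eq_bot, LinearMap.ker_eq_bot']
  intro x hx
  have : vecMulVec x ψ = 0 := hx
  rw [vecMulVec_eq_zero] at this
  exact this.resolve_right hψ

theorem range_vecMulVecBilin_mul_mem [Fintype ι] (ψ : ι → K) {A : Matrix ι ι K}
    (X : Matrix ι ι K) (hA : A ∈ LinearMap.range ((vecMulVecBilin K K).flip ψ)) :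
    X * A ∈ LinearMap.range ((vecMulVecBilin K K).flip ψ) := by
  obtain ⟨y, rfl⟩ := hA
  exact ⟨X *ᵥ y, by simp [vecMulVecBilin, mul_vecMulVec]⟩

theorem smul_eq_smul_of_vecMulVec_add [Fintype ι] {x y z g h k v w : ι → K}
    (hgv : g ⬝ᵥ v = 1) (hhv : h ⬝ᵥ v = 0) (hgw : g ⬝ᵥ w = 0) (hhw : h ⬝ᵥ w = 1)
    (e : vecMulVec x g + vecMulVec y h = vecMulVec z k) :
    x = (k ⬝ᵥ v) • z ∧ y = (k ⬝ᵥ w) • z := by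
  constructor
  · have := congrArg (· *ᵥ v) e
    simpa [add_mulVec, vecMulVec_mulVec, hgv, hhv] using this
  · have := congrArg (· *ᵥ w) e
    simpa [add_mulVec, vecMulVec_mulVec, hgw, hhw] using this

end Outer

variable {ι : Type*} [Fintype ι] [DecidableEq ι]

/-- Transvections minus `1` give the off-diagonal matrix units; expanding a product of two gives
`E_ik * E_ki = E_ii`. This works even over the field with two elements. -/
theorem span_units_matrix_eq_top {K : Type*} [CommRing K] :
    Submodule.span K (Set.range ((↑) : (Matrix ι ι K)ˣ → Matrix ι ι K)) = ⊤ := by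
  set W := Submodule.span K (Set.range ((↑) : (Matrix ι ι K)ˣ → Matrix ι ι K)) with hW
  have hu : ∀ A : Matrix ι ι K, IsUnit A → A ∈ W := fun A hA =>
    Submodule.subset_span ⟨hA.unit, rfl⟩
  have h1 : (1 : Matrix ι ι K) ∈ W := hu 1 isUnit_one
  have hne : ∀ i j : ι, i ≠ j → single i j (1 : K) ∈ W := by
    intro i j hij
    have ht : IsUnit (transvection i j (1 : K)) := by
      rw [isUnit_iff_isUnit_det, det_transvection_of_ne i j hij]
      exact isUnit_one
    have := W.sub_mem (hu _ ht) h1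
    simpa [transvection] using this
  have hmul : ∀ i j k l : ι, i ≠ j → k ≠ l → single i j (1 : K) * single k l (1 : K) ∈ W := by
    intro i j k l hij hkl
    have ht : IsUnit (transvection i j (1 : K) * transvection k l (1 : K)) := by
      rw [isUnit_iff_isUnit_det, det_mul, det_transvection_of_ne i j hij,
        det_transvection_of_ne k l hkl]
      simp
    have h := W.sub_mem (W.sub_mem (W.sub_mem (hu _ ht) h1) (hne i j hij)) (hne k l hkl)
    have e : transvection i j (1 : K) * transvection k l (1 : K) - 1 - single i j 1 - single k l 1
        = single i j (1 : K) * single k l (1 : K) := by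
      simp only [transvection]; noncomm_ring
    rwa [e] at h
  have hall : ∀ i j : ι, single i j (1 : K) ∈ W := by
    intro i j
    by_cases hij : i = j
    · subst hij
      by_cases hk : ∃ k, i ≠ k
      · obtain ⟨k, hk⟩ := hk
        simpa using hmul i k k i hk hk.symm
      · push Not at hk
        have : single i i (1 : K) = 1 := by
          ext a b
          obtain rfl := hk a
          obtain rfl := hk b
          simp
        rwa [this]
    · exact hne i j hij
  rw [eq_top_iff]
  rintro A -
  rw [matrix_eq_sum_single A]
  refine W.sum_mem fun i _ => W.sum_mem fun j _ => ?_
  have := W.smul_mem (A i j) (hall i j)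
  simpa [smul_single] using this

/-! ### The field case -/

section Field

variable {K : Type*} [Field K]

theorem exists_symm_vecMulVec_eq (T : Matrix ι ι K ≃ₗ[K] Matrix ι ι K)
    (hT : Preserves RelL T) {ψ : ι → K} (hψ : ψ ≠ 0) :
    ∃ φ : ι → K, φ ≠ 0 ∧ ∀ x : ι → K, ∃ y : ι → K, T.symm (vecMulVec x ψ) = vecMulVec y φ := by
  obtain ⟨B, hB0, hB⟩ : ∃ B : Matrix ι ι K, B ≠ 0 ∧
      T B ∈ LinearMap.range ((vecMulVecBilin K K (m := ι)).flip ψ) := by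
    refine ⟨T.symm (vecMulVec ψ ψ), ?_, ?_⟩
    · simp [hψ]
    · simp only [LinearEquiv.apply_symm_apply]
      exact ⟨ψ, rfl⟩
  have hmul : ∀ X : Matrix ι ι K,
      T (X * B) ∈ LinearMap.range ((vecMulVecBilin K K (m := ι)).flip ψ) := by
    intro X
    have hX : X ∈ Submodule.span K (Set.range ((↑) : (Matrix ι ι K)ˣ → Matrix ι ι K)) := by
      rw [span_units_matrix_eq_top]; trivial
    induction hX using Submodule.span_induction with
    | mem X hX =>
      obtain ⟨u, rfl⟩ := hX
      obtain ⟨Y, hY⟩ := (hT _ _ (relL_units_mul u B)).1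
      rw [hY]
      exact range_vecMulVecBilin_mul_mem ψ Y hB
    | zero => simp
    | add X Y _ _ hX hY => rw [add_mul, map_add]; exact Submodule.add_mem _ hX hY
    | smul c X _ hX => rw [smul_mul_assoc, map_smul]; exact Submodule.smul_mem _ c hX
  obtain ⟨i, hi⟩ : ∃ i, B i ≠ 0 := by
    by_contra! h
    exact hB0 (funext h)
  refine ⟨B i, hi, ?_⟩
  have hle : (LinearMap.range ((vecMulVecBilin K K (m := ι)).flip (B i))).map T.toLinearMap ≤
      LinearMap.range ((vecMulVecBilin K K (m := ι)).flip ψ) := by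
    rintro _ ⟨_, ⟨x, rfl⟩, rfl⟩
    have e : (vecMulVecBilin K K).flip (B i) x = vecMulVec x (Pi.single i 1) * B := by
      rw [vecMulVec_mul, single_one_vecMul]; rfl
    rw [e]
    exact hmul _
  -- Both spaces are copies of `ι → K`, so the inclusion is an equality.
  have heq := Submodule.eq_of_le_of_finrank_eq hle (by
    rw [LinearEquiv.finrank_map_eq,
      LinearMap.finrank_range_of_inj (vecMulVecBilin_flip_injective hi),
      LinearMap.finrank_range_of_inj (vecMulVecBilin_flip_injective hψ)])
  intro x
  have hx : vecMulVec x ψ ∈ LinearMap.range ((vecMulVecBilin K K (m := ι)).flip ψ) := ⟨x, rfl⟩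
  rw [← heq] at hx
  obtain ⟨_, ⟨y, rfl⟩, hy⟩ := hx
  refine ⟨y, ?_⟩
  rw [← hy]
  exact T.symm_apply_apply _

theorem exists_dotProduct_eq_one_of_ne_smul {g h : ι → K} (hh : h ≠ 0)
    (hgh : ∀ c : K, g ≠ c • h) : ∃ v : ι → K, g ⬝ᵥ v = 1 ∧ h ⬝ᵥ v = 0 := by
  obtain ⟨l, hl⟩ : ∃ l, h l ≠ 0 := by
    by_contra! H
    exact hh (funext H)
  obtain ⟨k, hk⟩ : ∃ k, g k * h l - g l * h k ≠ 0 := by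
    by_contra! H
    refine hgh (g l / h l) (funext fun k => ?_)
    have := H k
    simp only [Pi.smul_apply, smul_eq_mul]
    field_simp
    linear_combination this
  -- Cramer's rule on a nonzero 2×2 minor of `g`, `h`.
  refine ⟨(g k * h l - g l * h k)⁻¹ • (Pi.single k (h l) - Pi.single l (h k)), ?_, ?_⟩
  · simp only [dotProduct_smul, dotProduct_sub, dotProduct_single, smul_eq_mul]
    exact inv_mul_cancel₀ hk
  · simp only [dotProduct_smul, dotProduct_sub, dotProduct_single, smul_eq_mul]
    ring

/-- Pairing with vectors dual to the independent `g`, `h` makes `b x` and `c x` multiples of the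
same `z x`, with coefficients independent of `x`. -/
theorem exists_smul_of_vecMulVec_add {b c : (ι → K) → (ι → K)} {g h k : ι → K}
    (hc : Function.Surjective c) (hg : g ≠ 0) (hh : h ≠ 0) (hgh : ∀ t : K, g ≠ t • h)
    (hz : ∀ x, ∃ z, vecMulVec (b x) g + vecMulVec (c x) h = vecMulVec z k) :
    ∃ t : K, ∀ x, b x = t • c x := by
  obtain ⟨v, hgv, hhv⟩ := exists_dotProduct_eq_one_of_ne_smul hh hgh
  obtain ⟨w, hhw, hgw⟩ := exists_dotProduct_eq_one_of_ne_smul hg (g := h) fun t ht => by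
    have ht0 : t ≠ 0 := by
      rintro rfl
      exact hh (by simpa using ht)
    exact hgh t⁻¹ (by rw [ht, smul_smul, inv_mul_cancel₀ ht0, one_smul])
  choose z hz using hz
  have key := fun x => smul_eq_smul_of_vecMulVec_add hgv hhv hgw hhw (hz x)
  have hkw : k ⬝ᵥ w ≠ 0 := by
    intro h0
    obtain ⟨x, hx⟩ := hc h
    apply hh
    rw [← hx, (key x).2, h0, zero_smul]
  refine ⟨(k ⬝ᵥ v) / (k ⬝ᵥ w), fun x => ?_⟩
  rw [(key x).1, (key x).2, smul_smul, div_mul_cancel₀ _ hkw]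

/-- A linear map sending each matrix unit `single i j 1` to `vecMulVec (P i) (g j)` has the form
`A ↦ X * A * Y`. -/
theorem eq_mul_mul_of_vecMulVec {R : Type*} [CommSemiring R]
    (U : Matrix ι ι R →ₗ[R] Matrix ι ι R) (P : ι → ι → R) (g : ι → ι → R)
    (hU : ∀ i j, U (single i j 1) = vecMulVec (P i) (g j)) (A : Matrix ι ι R) :
    U A = (of P)ᵀ * A * of g := by
  have : U = (LinearMap.mulRight R (of g)).comp (LinearMap.mulLeft R (of P)ᵀ) := by
    apply ext_linearMap
    intro i j
    apply LinearMap.ext_ring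
    change U (single i j 1) = (of P)ᵀ * single i j 1 * of g
    rw [hU, single_eq_single_vecMulVec_single, mul_vecMulVec, vecMulVec_mul, mulVec_single_one,
      single_one_vecMul]
    rfl
  rw [this]
  rfl

theorem exists_mul_mul_of_preserves_relL_of_field (T : Matrix ι ι K ≃ₗ[K] Matrix ι ι K)
    (hT : Preserves RelL T) : ∃ P Q : Matrix ι ι K, ∀ A, T.symm A = P * A * Q := by
  choose! φ hφ b hb using fun ψ => exists_symm_vecMulVec_eq T hT (ψ := ψ)
  rcases isEmpty_or_nonempty ι with hι | ⟨⟨o⟩⟩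
  · exact ⟨0, 0, fun A => Subsingleton.elim _ _⟩
  let e : ι → ι → K := fun j => Pi.single j 1
  have he : ∀ j, e j ≠ 0 := fun j => by simp [e]
  have hinj : ∀ ψ : ι → K, ψ ≠ 0 → Function.Injective (b ψ) := by
    intro ψ hψ x y hxy
    apply vecMulVecBilin_flip_injective hψ
    apply T.symm.injective
    change T.symm (vecMulVec x ψ) = T.symm (vecMulVec y ψ)
    rw [hb ψ hψ, hb ψ hψ, hxy]
  have hadd : ∀ ψ : ι → K, ψ ≠ 0 → ∀ x y, b ψ (x + y) = b ψ x + b ψ y := by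
    intro ψ hψ x y
    apply vecMulVecBilin_flip_injective (hφ ψ hψ)
    change vecMulVec (b ψ (x + y)) (φ ψ) = vecMulVec (b ψ x + b ψ y) (φ ψ)
    rw [add_vecMulVec, ← hb ψ hψ, ← hb ψ hψ, ← hb ψ hψ, add_vecMulVec, map_add]
  have hsmul : ∀ ψ : ι → K, ψ ≠ 0 → ∀ (c : K) x, b ψ (c • x) = c • b ψ x := by
    intro ψ hψ c x
    apply vecMulVecBilin_flip_injective (hφ ψ hψ)
    change vecMulVec (b ψ (c • x)) (φ ψ) = vecMulVec (c • b ψ x) (φ ψ)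
    rw [smul_vecMulVec, ← hb ψ hψ, ← hb ψ hψ, smul_vecMulVec, map_smul]
  have hsurj : ∀ ψ : ι → K, ψ ≠ 0 → Function.Surjective (b ψ) := fun ψ hψ =>
    (LinearMap.injective_iff_surjective (f := (
      { toFun := b ψ, map_add' := hadd ψ hψ, map_smul' := hsmul ψ hψ } :
        (ι → K) →ₗ[K] (ι → K)))).1 (hinj ψ hψ)
  have hprop : ∀ j, ∃ t : K, ∀ x, b (e j) x = t • b (e o) x := by
    intro j
    by_cases hj : j = o
    · exact ⟨1, by simp [hj]⟩
    have hsum : e j + e o ≠ 0 := fun h => by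
      simpa [e, hj] using congrFun h j
    refine exists_smul_of_vecMulVec_add (k := φ (e j + e o)) (hsurj _ (he o)) (hφ _ (he j))
      (hφ _ (he o)) ?_ ?_
    -- Proportional `φ (e j)` and `φ (e o)` would make the images of two distinct columns meet,
    -- against injectivity.
    · intro t ht
      obtain ⟨y, hy⟩ := hsurj _ (he o) (t • b (e j) (e j))
      have : T.symm (vecMulVec y (e o)) = T.symm (vecMulVec (e j) (e j)) := by
        rw [hb _ (he o), hb _ (he j), hy, ht, vecMulVec_smul, smul_vecMulVec]
      have := congrFun (congrFun (T.symm.injective this) j) j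
      simp [e, vecMulVec_apply, hj] at this
    · intro x
      refine ⟨b (e j + e o) x, ?_⟩
      rw [← hb _ (he j), ← hb _ (he o), ← hb _ hsum, vecMulVec_add, map_add]
  choose t ht using hprop
  refine ⟨_, _, eq_mul_mul_of_vecMulVec T.symm.toLinearMap (fun i => b (e o) (e i))
    (fun j => t j • φ (e j)) fun i j => ?_⟩
  rw [single_eq_single_vecMulVec_single, vecMulVec_smul, ← smul_vecMulVec, ← ht]
  exact hb _ (he j) _

end Field

theorem relL_single {S : Type*} [Semifield S] {i k j : ι} : RelL (single i j (1 : S)) (single k j 1) :=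
  ⟨⟨single i k 1, by simp⟩, ⟨single k i 1, by simp⟩⟩

theorem col_eq_of_leL_single {S : Type*} [Semifield S] {p p' q q' : ι} {l l' : S} (hl : l ≠ 0)
    (h : LeL (single p q l) (single p' q' l')) : q = q' := by
  obtain ⟨X, hX⟩ := h
  by_contra hq
  have := congrFun (congrFun hX p) q
  rw [single_apply_same, mul_single_apply_of_ne _ _ _ _ _ hq] at this
  exact hl this

/-! ### Semifields without nonzero additive units -/

section ZeroSumFree

variable {S : Type*} [Semifield S] [Subsingleton (AddUnits S)]

/-- Expand a preimage of a matrix unit: off its support a vanishing sum has only vanishing terms, so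
any contributing `T (E_b)` is itself a multiple of that unit. -/
theorem exists_map_single_eq (T : Matrix ι ι S →ₗ[S] Matrix ι ι S) (hT : Function.Bijective T) :
    ∃ σ : ι × ι → ι × ι, Function.Bijective σ ∧ ∃ l : ι × ι → S, ∀ a, l a ≠ 0 ∧
      T (single a.1 a.2 1) = single (σ a).1 (σ a).2 (l a) := by
  have key : ∀ a : ι × ι, ∃ b : ι × ι, ∃ l : S, l ≠ 0 ∧
      T (single b.1 b.2 1) = single a.1 a.2 l := by
    intro a
    obtain ⟨M, hM⟩ := hT.2 (single a.1 a.2 1)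
    have hexp : T M = ∑ b : ι × ι, M b.1 b.2 • T (single b.1 b.2 1) := by
      conv_lhs => rw [matrix_eq_sum_single M]
      simp [Fintype.sum_prod_type, ← map_smul, smul_single]
    obtain ⟨b, hb⟩ : ∃ b : ι × ι, M b.1 b.2 * T (single b.1 b.2 1) a.1 a.2 ≠ 0 := by
      by_contra! H
      have := congrFun (congrFun (hexp.symm.trans hM) a.1) a.2
      simp [Matrix.sum_apply, H] at this
    refine ⟨b, T (single b.1 b.2 1) a.1 a.2, right_ne_zero_of_mul hb, ?_⟩
    ext i j
    by_cases hij : a.1 = i ∧ a.2 = j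
    · obtain ⟨rfl, rfl⟩ := hij
      simp
    · have := congrFun (congrFun (hexp.symm.trans hM) i) j
      rw [single_apply_of_ne _ _ _ _ _ hij, Matrix.sum_apply, Finset.sum_eq_zero_iff] at this
      have := this b (Finset.mem_univ _)
      rw [single_apply_of_ne _ _ _ _ _ hij]
      exact (mul_eq_zero.1 this).resolve_left (left_ne_zero_of_mul hb)
  choose τ l hl hτ using key
  have hτi : Function.Injective τ := by
    intro a a' h
    have h1 : single a.1 a.2 (l a) = single a'.1 a'.2 (l a') := by rw [← hτ, ← hτ, h]
    have := congrFun (congrFun h1 a.1) a.2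
    rw [single_apply_same, single_apply] at this
    split_ifs at this with h2
    · exact (Prod.ext h2.1 h2.2).symm
    · exact absurd this (hl a)
  let E := Equiv.ofBijective τ (Finite.injective_iff_bijective.1 hτi)
  refine ⟨E.symm, E.symm.bijective, fun a => l (E.symm a), fun a => ⟨hl _, ?_⟩⟩
  rw [← hτ]
  have : τ (E.symm a) = a := E.apply_symm_apply a
  rw [this]

theorem exists_mul_mul_of_preserves_relL_of_zeroSumFree (T : Matrix ι ι S →ₗ[S] Matrix ι ι S)
    (hT : Function.Bijective T) (hL : Preserves RelL T) :
    ∃ P Q : Matrix ι ι S, ∀ A, T A = P * A * Q := by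
  rcases isEmpty_or_nonempty ι with hι | ⟨⟨o⟩⟩
  · exact ⟨0, 0, fun A => Subsingleton.elim _ _⟩
  obtain ⟨σ, hσ, l, hl⟩ := exists_map_single_eq T hT
  let p : ι → ι → ι := fun i j => (σ (i, j)).1
  let q : ι → ι := fun j => (σ (o, j)).2
  let m : ι → ι → S := fun i j => l (i, j)
  have hm : ∀ i j, m i j ≠ 0 := fun i j => (hl (i, j)).1
  have hq : ∀ i j, (σ (i, j)).2 = q j := by
    intro i j
    have h := (hL _ _ (relL_single (S := S) (i := i) (k := o) (j := j))).1
    rw [(hl (i, j)).2, (hl (o, j)).2] at h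
    exact col_eq_of_leL_single (hm i j) h
  have hTs : ∀ i j, T (single i j 1) = single (p i j) (q j) (m i j) := by
    intro i j
    rw [← hq i j]
    exact (hl (i, j)).2
  have hpq : ∀ i j i' j', p i j = p i' j' → q j = q j' → i = i' ∧ j = j' := by
    intro i j i' j' h1 h2
    have := hσ.1 (a₁ := (i, j)) (a₂ := (i', j'))
      (Prod.ext h1 (by rw [hq, hq, h2]))
    simpa using this
  have hp : ∀ j, Function.Surjective fun i => p i j := fun j =>
    Finite.surjective_of_injective fun i i' h => (hpq i j i' j h rfl).1
  have hqi : Function.Injective q := by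
    intro j j' h
    obtain ⟨i, hi⟩ := hp j' (p o j)
    exact (hpq o j i j' hi.symm h).2
  have hpo : ∀ i j, p i j = p i o := by
    intro i j
    by_cases hj : j = o
    · rw [hj]
    -- Column `q o` of the image of the full sum below has no zero entry. If `p i j ≠ p i o`, a zero
    -- there on the left kills row `p i j` of `X`, hence also the nonzero entry in column `q j`.
    by_contra hne
    have hqj : q j ≠ q o := fun h => hj (hqi h)
    have hrel : RelL (single i j (1 : S) + single i o 1)
        (∑ r, (single r j (1 : S) + single r o 1)) := by
      constructor
      · refine ⟨single i i 1, ?_⟩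
        ext a b
        rw [Matrix.mul_apply]
        simp [single_apply, Matrix.sum_apply, Finset.sum_add_distrib, ite_and]
        split_ifs <;> simp
      · refine ⟨∑ r, single r i 1, ?_⟩
        simp [Finset.sum_mul, mul_add, Finset.sum_add_distrib]
    obtain ⟨X, hX⟩ := (hL _ _ hrel).1
    simp only [map_add, map_sum, hTs] at hX
    have h1 := congrFun (congrFun hX (p i j)) (q o)
    have h2 := congrFun (congrFun hX (p i j)) (q j)
    rw [Matrix.add_apply, single_apply_of_col_ne _ _ hqj,
      single_apply_of_row_ne (Ne.symm hne), add_zero, mul_apply, eq_comm,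
      Finset.sum_eq_zero_iff] at h1
    rw [Matrix.add_apply, single_apply_same, single_apply_of_col_ne _ _ hqj.symm,
      add_zero, mul_apply, Finset.sum_eq_zero] at h2
    · exact hm i j h2
    · intro r _
      have h3 := h1 r (Finset.mem_univ _)
      obtain ⟨s, hs⟩ := hp o r
      have hs' : p s o = r := hs
      refine mul_eq_zero_of_left ((mul_eq_zero.1 h3).resolve_right fun h4 => ?_) _
      rw [Matrix.sum_apply, Finset.sum_eq_zero_iff] at h4
      have h5 := h4 s (Finset.mem_univ _)
      rw [Matrix.add_apply, single_apply_of_col_ne _ _ hqj, zero_add, hs',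
        single_apply_same] at h5
      exact hm s o h5
  -- The scalars have rank one: a single entry of `X` relates columns `q j` and `q o`
  -- simultaneously.
  have hmm : ∀ i j, m i j * m o o = m i o * m o j := by
    intro i j
    by_cases hj : j = o
    · rw [hj]
    have hqj : q j ≠ q o := fun h => hj (hqi h)
    have hrel : RelL (single i j (1 : S) + single i o 1) (single o j 1 + single o o 1) :=
      ⟨⟨single i o 1, by simp [mul_add]⟩, ⟨single o i 1, by simp [mul_add]⟩⟩
    obtain ⟨X, hX⟩ := (hL _ _ hrel).1
    simp only [map_add, hTs, hpo, mul_add] at hX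
    have h1 := congrFun (congrFun hX (p i o)) (q o)
    have h2 := congrFun (congrFun hX (p i o)) (q j)
    simp [hqj, hqj.symm] at h1 h2
    rw [h1, h2]
    ring
  refine ⟨_, _, eq_mul_mul_of_vecMulVec T (fun i => Pi.single (p i o) (m i o))
    (fun j => Pi.single (q j) (m o j / m o o)) fun i j => ?_⟩
  rw [hTs, hpo]
  have : m i j = m i o * (m o j / m o o) := by
    rw [← mul_div_assoc, ← hmm, mul_div_cancel_right₀ _ (hm o o)]
  ext a b
  rw [single_apply, vecMulVec_apply, Pi.single_apply, Pi.single_apply, this]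
  grind

end ZeroSumFree

/-! ### Merging the two cases, transposition and the converse -/

/-- The field structure on a semifield containing an additive inverse of `1`. -/
abbrev fieldOfAddInverseOne {S : Type*} [h : Semifield S] (c : S) (hc : c + 1 = 0) : Field S :=
  letI : Neg S := ⟨fun a => c * a⟩
  { h with
    zsmul := zsmulRec
    neg_add_cancel := fun a => by
      change c * a + a = 0
      rw [← add_one_mul, hc, zero_mul]
    qsmul := _ }

/-- A preimage of `1` gives one-sided inverses, which are two-sided for square matrices over a
commutative semiring. -/
theorem units_of_surjective {S : Type*} [CommSemiring S] (T : Matrix ι ι S → Matrix ι ι S)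
    (hT : Function.Surjective T) {P Q : Matrix ι ι S} (h : ∀ A, T A = P * A * Q) :
    IsUnit P ∧ IsUnit Q := by
  obtain ⟨A, hA⟩ := hT 1
  rw [h] at hA
  refine ⟨IsUnit.of_mul_eq_one (A * Q) (by rw [← mul_assoc, hA]), ?_⟩
  exact IsUnit.of_mul_eq_one_right (P * A) hA

theorem exists_units_mul_mul_of_preserves_relL {S : Type*} [Semifield S]
    (T : Matrix ι ι S →ₗ[S] Matrix ι ι S) (hT : Function.Bijective T) (hL : Preserves RelL T) :
    ∃ P Q : (Matrix ι ι S)ˣ, ∀ A, T A = (P : Matrix ι ι S) * A * (Q : Matrix ι ι S) := by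
  by_cases hS : ∃ c : S, c + 1 = 0
  · obtain ⟨c, hc⟩ := hS
    let _ := fieldOfAddInverseOne c hc
    have := @exists_mul_mul_of_preserves_relL_of_field ι _ _ S (fieldOfAddInverseOne c hc)
      (LinearEquiv.ofBijective T hT) hL
    obtain ⟨P, Q, h⟩ := this
    obtain ⟨⟨P, rfl⟩, ⟨Q, rfl⟩⟩ := units_of_surjective _ (LinearEquiv.surjective _) h
    refine ⟨P⁻¹, Q⁻¹, fun A => ?_⟩
    have h1 := h (T A)
    have h2 : (LinearEquiv.ofBijective T hT).symm (T A) = A :=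
      (LinearEquiv.ofBijective T hT).symm_apply_apply A
    rw [h2] at h1
    conv_rhs => rw [h1]
    simp [mul_assoc]
  · have : Subsingleton (AddUnits S) := by
      refine ⟨fun u v => ?_⟩
      have hz : ∀ u : AddUnits S, (u : S) = 0 := by
        intro u
        by_contra hu
        -- Dividing by a nonzero additive unit turns its negative into `-1`.
        exact hS ⟨(u : S)⁻¹ * ↑(-u), by
          rw [← inv_mul_cancel₀ hu, ← mul_add, AddUnits.neg_add, mul_zero]⟩
      exact AddUnits.ext ((hz u).trans (hz v).symm)
    obtain ⟨P, Q, h⟩ := exists_mul_mul_of_preserves_relL_of_zeroSumFree T hT hL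
    obtain ⟨⟨P, rfl⟩, ⟨Q, rfl⟩⟩ := units_of_surjective _ hT.2 h
    exact ⟨P, Q, h⟩

theorem leL_transpose {S : Type*} [CommSemiring S] {A B : Matrix ι ι S} (h : LeL A B) :
    LeR Aᵀ Bᵀ := by
  obtain ⟨X, rfl⟩ := h
  exact ⟨Xᵀ, transpose_mul _ _⟩

theorem leR_transpose {S : Type*} [CommSemiring S] {A B : Matrix ι ι S} (h : LeR A B) :
    LeL Aᵀ Bᵀ := by
  obtain ⟨X, rfl⟩ := h
  exact ⟨Xᵀ, transpose_mul _ _⟩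

theorem exists_units_mul_mul_of_preserves_relR {S : Type*} [Semifield S]
    (T : Matrix ι ι S →ₗ[S] Matrix ι ι S) (hT : Function.Bijective T) (hR : Preserves RelR T) :
    ∃ P Q : (Matrix ι ι S)ˣ, ∀ A, T A = (P : Matrix ι ι S) * A * (Q : Matrix ι ι S) := by
  let t := transposeLinearEquiv ι ι S S
  obtain ⟨P, Q, h⟩ := exists_units_mul_mul_of_preserves_relL (t.toLinearMap ∘ₗ T ∘ₗ t.toLinearMap)
    (t.bijective.comp (hT.comp t.bijective)) fun A B hAB => by
      have := hR _ _ ⟨leL_transpose hAB.1, leL_transpose hAB.2⟩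
      exact ⟨leR_transpose this.1, leR_transpose this.2⟩
  have hu : ∀ U : (Matrix ι ι S)ˣ, ∃ V : (Matrix ι ι S)ˣ, (V : Matrix ι ι S) = (↑U)ᵀ := fun U =>
    ⟨⟨(↑U)ᵀ, (↑U⁻¹ : Matrix ι ι S)ᵀ, by rw [← transpose_mul, U.inv_mul, transpose_one],
      by rw [← transpose_mul, U.mul_inv, transpose_one]⟩, rfl⟩
  obtain ⟨P', hP⟩ := hu P
  obtain ⟨Q', hQ⟩ := hu Q
  refine ⟨Q', P', fun A => ?_⟩
  have := congrArg transpose (h Aᵀ)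
  rw [transpose_mul, transpose_mul, transpose_transpose, ← hP, ← hQ, ← mul_assoc] at this
  exact this

theorem preserves_leL_mul_mul {M : Type*} [Monoid M] (f : M → M) (P Q : Mˣ)
    (hf : ∀ a, f a = P * a * Q) : Preserves LeL f := by
  rintro _ b ⟨x, rfl⟩
  exact ⟨P * x * ↑P⁻¹, by simp [hf, mul_assoc]⟩

theorem preserves_leR_mul_mul {M : Type*} [Monoid M] (f : M → M) (P Q : Mˣ)
    (hf : ∀ a, f a = P * a * Q) : Preserves LeR f := by
  rintro _ b ⟨x, rfl⟩
  exact ⟨↑Q⁻¹ * x * Q, by simp [hf, mul_assoc]⟩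

end Green

theorem mainTheorem2 {S : Type*} [Semifield S] (n : ℕ)
    (T : Matrix (Fin n) (Fin n) S →ₗ[S] Matrix (Fin n) (Fin n) S)
    (hT : Function.Bijective T) :
    List.TFAE [
      Green.Preserves Green.RelL T,
      Green.Preserves Green.RelR T,
      Green.Preserves Green.LeL T,
      Green.Preserves Green.LeR T,
      ∃ P Q : Matrix.GeneralLinearGroup (Fin n) S, ∀ A : Matrix (Fin n) (Fin n) S,
        T A = (P : Matrix (Fin n) (Fin n) S) * A * (Q : Matrix (Fin n) (Fin n) S)] := by
  tfae_have 3 → 1 := fun h A B hAB => ⟨h _ _ hAB.1, h _ _ hAB.2⟩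
  tfae_have 4 → 2 := fun h A B hAB => ⟨h _ _ hAB.1, h _ _ hAB.2⟩
  tfae_have 1 → 5 := Green.exists_units_mul_mul_of_preserves_relL T hT
  tfae_have 2 → 5 := Green.exists_units_mul_mul_of_preserves_relR T hT
  tfae_have 5 → 3 := fun ⟨P, Q, h⟩ => Green.preserves_leL_mul_mul T P Q h
  tfae_have 5 → 4 := fun ⟨P, Q, h⟩ => Green.preserves_leR_mul_mul T P Q h
  tfae_finish
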